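/- Let $G$ be a finite group and $p$ a prime. Let $R$ be the ring of all algebraic integers in $\mathbb{C}$, $K$ its field of fractions, $I$ a maximal ideal of $R$ containing $p$, and $F=R/I$. The Brauer character of an $F$-representation of $G$ is defined by lifting eigenvalues through the isomorphism $R\to F$ induces between the $|G|_{p'}$-th roots of unity in $R$ and those in $F$ (where $|G|_{p'}$ is the largest divisor of $|G|$ prime to $p$), and is extended by $0$ to the $p$-singular elements of $G$ (those of order divisible by $p$). Let $\mathrm{Irr}(G)$ and $\mathrm{IBr}(G)$ be the sets of irreducible $K$-characters and of irreducible Brauer characters of $G$, and let the decomposition numbers $d_{\chi\varphi}\in\mathbb{Z}_{\ge 0}$ be defined by $\hat\chi=\sum_{\varphi\in \mathrm{IBr}(G)} d_{\chi\varphi}\varphi$ for $\chi\in\mathrm{Irr}(G)$, where $\hat\chi$ agrees with $\chi$ on elements of order prime to $p$ and is $0$ elsewhere. The projective indecomposable characters (PIMs) are $\Phi_\varphi=\sum_{\chi\in\mathrm{Irr}(G)} d_{\chi\varphi}\chi$, $\varphi\in\mathrm{IBr}(G)$; a projective character is a linear combination of PIMs with non-negative integral coefficients. Put $\langle\lambda,\mu\rangle=\frac1{|G|}\sum_{g\in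 G}\lambda(g)\overline{\mu(g)}$. The blocks of $G$ are the connected components of the graph on $\mathrm{Irr}(G)$ in which $\chi,\psi$ are linked if $d_{\chi\varphi}\ne0\ne d_{\psi\varphi}$ for some $\varphi\in\mathrm{IBr}(G)$. Let $B$ be a union of blocks and $\mathrm{IBr}(B)$ the set of those $\varphi\in\mathrm{IBr}(G)$ with $d_{\chi\varphi}\neq 0$ for some $\chi$ in $B$. Let $\{\varphi_1,\dots,\varphi_s\}$ be a basic set of Brauer characters of $B$, i.e. a $\mathbb{Z}$-basis, consisting of Brauer characters, of the $\mathbb{Z}$-span of $\mathrm{IBr}(B)$. Let $\{\varphi_1^*,\dots,\varphi_s^*\}$ (the projective atoms) be the basis of $K_0(B)=\langle \Phi_\varphi\mid\varphi\in\mathrm{IBr}(B)\rangle_{\mathbb{Z}}$ dual to it: $\langle\varphi_i,\varphi_j^*\rangle=\delta_{ij}$. Let $\mathbf{B}$ be any set of Brauer characters of $G$. Let $\Phi\neq 0$ be a projective character lying in $K_0(B)$, and write $\Phi=\sum_i n_i\varphi_i^*$ with $n_i\in\mathbb{Z}$. A part of $\Phi$ is a function $\Phi'=\sum_i n_i'\varphi_i^*$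 with integers $0\le n_i'\le n_i$ for all $i$. **Theorem (PIM-test).** Suppose that for every part $\Phi'$ of $\Phi$ with $\Phi'\ne\Phi$ and $\Phi'\neq0$ there is $\varphi\in\mathbf{B}$ with $\langle\varphi,\Phi'\rangle<0$ or $\langle\varphi,\Phi-\Phi'\rangle<0$. Then $\Phi$ is indecomposable, that is, $\Phi$ is not a sum of two nonzero projective characters; equivalently, $\Phi$ is one of the PIMs. -/

import Mathlib

open scoped ComplexOrder

noncomputable section

namespace PIMTest

attribute [local instance] Ideal.Quotient.field

/-! ### The modular system `(K, R, F)` -/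

/-- The field `K` of all algebraic numbers, as a subfield of `ℂ`. It is the field of fractions of
the ring `R` below. -/
abbrev K : Type := algebraicClosure ℚ ℂ

/-- The ring `R` of all algebraic integers. -/
abbrev R : Type := integralClosure ℤ K

/-- The residue class field `F = R / I` of a maximal ideal `I` of `R`. -/
abbrev F (I : Ideal R) : Type := R ⧸ I

section Characters

variable (G : Type*) [Group G]

/-- The set `Irr(G)` of the characters of irreducible `K`-representations of `G`
(regarded as complex valued functions). -/
def Irr : Set (G → ℂ) :=
  {χ | ∃ (n : ℕ) (X : Representation K G (Fin n → K)),
    X.IsIrreducible ∧ χ = fun g => ((X.character g : K) : ℂ)}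

variable {G} (p : ℕ)

/-- `restr p χ` is `χ̂`: it agrees with `χ` on the `p`-regular elements (those of order not
divisible by `p`) and it is zero on the `p`-singular elements. -/
def restr (χ : G → ℂ) : G → ℂ :=
  fun g => if p ∣ orderOf g then 0 else χ g

variable (G) (I : Ideal R)

/-- The inverse `ρ⁻¹` of the bijection `ρ` from the set of `|G|_{p'}`-th roots of unity of `R`
onto the nonzero elements of finite order dividing `|G|_{p'}` of `F = R / I`, which is induced by
the canonical epimorphism `R → F`. Here `|G|_{p'}` is the largest divisor of `|G|` prime to `p`. -/
def rootLift : F I → R :=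
  Function.invFunOn (Ideal.Quotient.mk I)
    {z : R | z ^ (Nat.card G / p ^ (Nat.card G).factorization p) = 1}

variable [I.IsMaximal]

variable {G} in
/-- The Brauer character afforded by an `F`-representation `X`: at a `p`-regular element `g` its
value is the sum of the lifts of the eigenvalues of `X g` (with multiplicities), and it is
extended by zero to the `p`-singular elements. -/
def brauerCharacter {n : ℕ} (X : Representation (F I) G (Fin n → F I)) : G → ℂ :=
  restr p fun g => (((X g).charpoly.roots.map fun z => ((rootLift G p I z : K) : ℂ)).sum)

/-- The set of all (genuine) Brauer characters of `G`. -/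
def BrauerCharacters : Set (G → ℂ) :=
  {ϑ | ∃ (n : ℕ) (X : Representation (F I) G (Fin n → F I)), ϑ = brauerCharacter p I X}

/-- The set `IBr(G)` of irreducible Brauer characters of `G`. -/
def IBr : Set (G → ℂ) :=
  {ϑ | ∃ (n : ℕ) (X : Representation (F I) G (Fin n → F I)),
    X.IsIrreducible ∧ ϑ = brauerCharacter p I X}

variable {G}

/-- The decomposition numbers `d_{χφ}` (`φ ∈ IBr(G)`) of `χ ∈ Irr(G)`: the non-negative integers
defined by `χ̂ = ∑_φ d_{χφ} φ`. -/
def decompositionNumber (χ : Irr G) : IBr G p I →₀ ℕ :=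
  Classical.epsilon fun d : IBr G p I →₀ ℕ =>
    restr p (χ : G → ℂ) = d.sum fun φ m => m • (φ : G → ℂ)

/-- The projective indecomposable character `Φ_φ = ∑_χ d_{χφ} χ` (`χ` running over the finite set
`Irr(G)`) corresponding to `φ ∈ IBr(G)`. -/
def pim (φ : IBr G p I) : G → ℂ :=
  ∑ᶠ χ : Irr G, decompositionNumber p I χ φ • (χ : G → ℂ)

variable (G)

/-- The set `IPr(G)` of projective indecomposable characters (PIMs) of `G`. -/
def IPr : Set (G → ℂ) := Set.range (pim (G := G) p I)

/-- The set of (genuine) projective characters of `G`: the linear combinations of PIMs with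
non-negative integral coefficients. -/
def ProjectiveCharacters : AddSubmonoid (G → ℂ) := AddSubmonoid.closure (IPr G p I)

/-! ### Blocks -/

/-- The Brauer graph: its vertex set is `Irr(G)`, and distinct `χ`, `ψ` are linked by an edge if
`d_{χφ} ≠ 0 ≠ d_{ψφ}` for some `φ ∈ IBr(G)`. -/
def brauerGraph : SimpleGraph (Irr G) :=
  SimpleGraph.fromRel fun χ ψ => ∃ φ : IBr G p I,
    decompositionNumber p I χ φ ≠ 0 ∧ decompositionNumber p I ψ φ ≠ 0

/-- A block of `G` is a connected component of the Brauer graph. A union of blocks is given as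
the set of the blocks that it consists of. -/
abbrev Block : Type _ := (brauerGraph G p I).ConnectedComponent

variable {G} {p} {I}

/-- `Irr(B)`, for a union `B` of blocks. -/
def IrrB (B : Set (Block G p I)) : Set (Irr G) :=
  {χ | (brauerGraph G p I).connectedComponentMk χ ∈ B}

/-- `IBr(B)`: the irreducible Brauer characters that occur in `χ̂` for some `χ ∈ Irr(B)`. -/
def IBrB (B : Set (Block G p I)) : Set (IBr G p I) :=
  {φ | ∃ χ ∈ IrrB B, decompositionNumber p I χ φ ≠ 0}

/-- `G₀(B̂)`: the group of all `ℤ`-linear combinations of `IBr(B)`. -/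
def G0hat (B : Set (Block G p I)) : Submodule ℤ (G → ℂ) :=
  Submodule.span ℤ ((fun φ : IBr G p I => (φ : G → ℂ)) '' IBrB B)

/-- `K₀(B)`: the group of all `ℤ`-linear combinations of the PIMs in `B`. -/
def K0 (B : Set (Block G p I)) : Submodule ℤ (G → ℂ) :=
  Submodule.span ℤ (pim p I '' IBrB B)

/-! ### Basic sets, atoms and parts -/

/-- The inner product `⟨λ, μ⟩ = |G|⁻¹ ∑_g λ(g) \overline{μ(g)}`. -/
def charInner {G : Type*} [Fintype G] (l m : G → ℂ) : ℂ :=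
  (Fintype.card G : ℂ)⁻¹ * ∑ g, l g * (starRingEnd ℂ) (m g)

/-- The family `v` is a `ℤ`-basis of the group `M` of functions on `G`. -/
def IsZBasis {ι : Type*} (M : Submodule ℤ (G → ℂ)) (v : ι → G → ℂ) : Prop :=
  LinearIndependent ℤ v ∧ Submodule.span ℤ (Set.range v) = M

/-- A basic set of Brauer characters of `B`: a `ℤ`-basis of `G₀(B̂)` consisting of (genuine)
Brauer characters. -/
def IsBasicSet {ι : Type*} (B : Set (Block G p I)) (BS : ι → G → ℂ) : Prop :=
  IsZBasis (G0hat B) BS ∧ ∀ i, BS i ∈ BrauerCharacters G p I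

/-- `PA` is the basis of `K₀(B)` which is dual to `BS` with respect to the inner product: the
system of projective atoms belonging to `BS`. -/
def IsDualAtoms {ι : Type*} [DecidableEq ι] [Fintype G] (B : Set (Block G p I))
    (BS PA : ι → G → ℂ) : Prop :=
  IsZBasis (K0 B) PA ∧ ∀ i j, charInner (BS i) (PA j) = if i = j then 1 else 0

end Characters

/-- `Φ'` is a part of `Φ` with respect to `PA`: in the expansions `Φ = ∑ nᵢ PAᵢ` and
`Φ' = ∑ nᵢ' PAᵢ` with integral coefficients one has `0 ≤ nᵢ' ≤ nᵢ` for all `i`. -/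
def IsPart {G ι : Type*} [Fintype ι] (PA : ι → G → ℂ) (Φ Φ' : G → ℂ) : Prop :=
  ∃ n n' : ι → ℤ, Φ = ∑ i, n i • PA i ∧ Φ' = ∑ i, n' i • PA i ∧ ∀ i, 0 ≤ n' i ∧ n' i ≤ n i

/-- A projective character is indecomposable if it is nonzero and not the sum of two nonzero
projective characters. -/
def IsIndecomposable {G : Type*} [Group G] (p : ℕ) (I : Ideal R) [I.IsMaximal]
    (Φ : G → ℂ) : Prop :=
  Φ ∈ ProjectiveCharacters G p I ∧ Φ ≠ 0 ∧
    ∀ Φ₁ ∈ ProjectiveCharacters G p I, ∀ Φ₂ ∈ ProjectiveCharacters G p I,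
      Φ = Φ₁ + Φ₂ → Φ₁ = 0 ∨ Φ₂ = 0

end PIMTest

end

noncomputable section

namespace PIMTest

attribute [local instance] Ideal.Quotient.field

open Polynomial Module

/-! Brauer characters pair with projective characters to non-negative integers. Hence, if Φ = Φ₁ +
Φ₂ with projective summands, pairing with the irreducible Brauer characters outside B forces both
summands into K₀(B) (`mem_K0_of_add_mem_K0`), and pairing with the basic set shows that their atom
coefficients are non-negative (`exists_nonneg_coefficients`). So Φ₁ is a part of Φ, and if both
summands were nonzero the test would yield a negative pairing of a Brauer character with Φ₁ or Φ₂.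

The integrality comes from `charInner_pim`: ⟨θ, Φ_ψ⟩ is the multiplicity of ψ in θ. Expand θ = ∑ a_χ
χ as a class function, with a_χ = ⟨θ, χ⟩. On p-regular elements this reads θ = ∑ a_χ d_{χφ} φ, so
independence of IBr(G) over K gives the multiplicity ∑ a_χ d_{χψ} = ⟨θ, Φ_ψ⟩. Three classical facts
enter: Irr(G) spans the class functions (`exists_irr_expansion`), IBr(G) is independent
(`linearIndependent_IBr`), and decomposition numbers exist (`restr_eq_decompositionNumber_sum`). The
last two reduce modulo I through a valuation ring of K with residue field F
(`exists_valuationSubring`). -/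

/-! ### Characteristic polynomials along composition series. -/

open Module.Basis in
theorem charpoly_eq_restrict_mul_mapQ {k V : Type*} [Field k] [AddCommGroup V] [Module k V]
    [FiniteDimensional k V] (W : Submodule k V) (e : V →ₗ[k] V) (he : W ≤ W.comap e) :
    e.charpoly = (e.restrict he).charpoly * (W.mapQ W e he).charpoly := by
  let m := Module.Free.ChooseBasisIndex k W
  let bW : Basis m k W := Module.Free.chooseBasis k W
  let n := Module.Free.ChooseBasisIndex k (V ⧸ W)
  let bQ : Basis n k (V ⧸ W) := Module.Free.chooseBasis k (V ⧸ W)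
  let b := sumQuot bW bQ
  let A : Matrix m m k := LinearMap.toMatrix bW bW (e.restrict he)
  let B : Matrix m n k := Matrix.of fun i l ↦
    ((sumQuot bW bQ).repr (e ((sumQuot bW bQ) (Sum.inr l)))) (Sum.inl i)
  let D : Matrix n n k := LinearMap.toMatrix bQ bQ (W.mapQ W e he)
  suffices LinearMap.toMatrix b b e = Matrix.fromBlocks A B 0 D by
    rw [← LinearMap.charpoly_toMatrix e b, this, ← LinearMap.charpoly_toMatrix _ bW,
      ← LinearMap.charpoly_toMatrix _ bQ, Matrix.charpoly_fromBlocks_zero₂₁]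
  ext u v
  cases u with
  | inl i =>
    cases v with
    | inl k =>
      simp only [b, sumQuot_inl, Matrix.fromBlocks_apply₁₁, A, LinearMap.toMatrix_apply]
      apply sumQuot_repr_inl_of_mem
    | inr l => simp [b, LinearMap.toMatrix_apply, Matrix.fromBlocks_apply₁₂, B]
  | inr j =>
    cases v with
    | inl k =>
      suffices W.mkQ (e (bW k)) = 0 by simp [LinearMap.toMatrix_apply, b, this]
      rw [← LinearMap.mem_ker, Submodule.ker_mkQ]
      exact he (Submodule.coe_mem (bW k))
    | inr l =>
      simp only [LinearMap.toMatrix_apply, sumQuot_repr_inr,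
        Matrix.fromBlocks_apply₂₂, b, D]
      rw [← sumQuot_inr bW bQ l, W.mapQ_apply]
      simp

/-- Every finite-dimensional representation can be written on a coordinate space without changing
the characteristic polynomials. -/
theorem exists_coordinate_representation {k G V : Type*} [Field k] [Group G] [AddCommGroup V]
    [Module k V] [FiniteDimensional k V] (ρ : Representation k G V) :
    ∃ X : Representation k G (Fin (finrank k V) → k), ∀ g, (X g).charpoly = (ρ g).charpoly := by
  let e := (finBasis k V).equivFun
  exact ⟨((e.conjRingEquiv : End k V ≃+* _) : End k V →* End k _).comp ρ,
    fun g => e.charpoly_conj (ρ g)⟩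

/-- An additive invariant of characteristic polynomials takes its values on all representations in
the submonoid generated by its values on irreducible ones. -/
theorem charpoly_invariant_mem {k G A : Type*} [Field k] [Group G] [AddCommMonoid A]
    (T : G → k[X] → A) (hT1 : ∀ g, T g 1 = 0)
    (hT : ∀ g P Q, P.Monic → Q.Monic → T g (P * Q) = T g P + T g Q) (C : AddSubmonoid (G → A))
    (hC : ∀ (n : ℕ) (X : Representation k G (Fin n → k)), X.IsIrreducible →
      (fun g => T g (X g).charpoly) ∈ C)
    (n : ℕ) (X : Representation k G (Fin n → k)) : (fun g => T g (X g).charpoly) ∈ C := by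
  induction n using Nat.strong_induction_on with
  | _ n ih =>
  by_cases hX : X.IsIrreducible
  · exact hC n X hX
  rcases Nat.eq_zero_or_pos n with rfl | hn
  · convert C.zero_mem using 1
    funext g
    have : (X g).charpoly = 1 := by
      refine (X g).charpoly_monic.natDegree_eq_zero.mp ?_
      simp [LinearMap.charpoly_natDegree]
    simp [this, hT1]
  -- A proper nonzero subrepresentation and its quotient both have smaller dimension, and the
  -- characteristic polynomials multiply.
  obtain ⟨W, hW0, hW1⟩ : ∃ W : Subrepresentation X, W ≠ ⊥ ∧ W ≠ ⊤ := by
    by_contra! h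
    have : NeZero n := ⟨hn.ne'⟩
    have : Nontrivial (Subrepresentation X) := ⟨⊥, ⊤, fun h => by
      have h' : (⊥ : Submodule k (Fin n → k)) = ⊤ := congrArg Subrepresentation.toSubmodule h
      exact bot_ne_top h'⟩
    exact hX ⟨fun W => or_iff_not_imp_left.mpr (h W)⟩
  have hle : ∀ g, W.toSubmodule ≤ W.toSubmodule.comap (X g) := fun g => W.apply_mem_toSubmodule g
  obtain ⟨Y, hY⟩ := exists_coordinate_representation W.toRepresentation
  obtain ⟨Z, hZ⟩ := exists_coordinate_representation (X.quotient W.toSubmodule hle)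
  have hW0' : W.toSubmodule ≠ ⊥ := fun h => hW0 (Subrepresentation.toSubmodule_injective h)
  have hW1' : W.toSubmodule ≠ ⊤ := fun h => hW1 (Subrepresentation.toSubmodule_injective h)
  have h1 := Submodule.finrank_lt hW1'
  have h2 : finrank k (_ ⧸ W.toSubmodule) < finrank k (Fin n → k) := by
    have := Submodule.finrank_quotient_add_finrank W.toSubmodule
    have : 0 < finrank k W.toSubmodule := by
      rw [Nat.pos_iff_ne_zero]
      simpa using hW0'
    omega
  rw [finrank_fin_fun] at h1 h2
  convert C.add_mem (ih _ h1 Y) (ih _ h2 Z) using 1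
  funext g
  simp only [Pi.add_apply]
  rw [hY, hZ, charpoly_eq_restrict_mul_mapQ W.toSubmodule (X g) (hle g),
    hT _ _ _ (LinearMap.charpoly_monic _) (LinearMap.charpoly_monic _)]
  rfl

/-! ### Density and independence of irreducible characters. -/

section density

variable {k G ι : Type*} [Field k] [IsAlgClosed k] [Group G] [Fintype ι] [DecidableEq ι]
  {V : ι → Type*} [∀ i, AddCommGroup (V i)] [∀ i, Module k (V i)] [∀ i, FiniteDimensional k (V i)]

/-- By Schur's lemma, module endomorphisms of ⨁ V i act as scalars on each summand and do not mix
summands. So "T on V i, zero elsewhere" commutes with all of them, and Jacobson density realises it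
by the group algebra. -/
theorem exists_asAlgebraHom_eq (X : ∀ i, Representation k G (V i))
    (hX : ∀ i, (X i).IsIrreducible) (hne : ∀ i j, i ≠ j → IsEmpty ((X i).Equiv (X j)))
    (i : ι) (T : End k (V i)) :
    ∃ r : MonoidAlgebra k G, (X i).asAlgebraHom r = T ∧ ∀ j ≠ i, (X j).asAlgebraHom r = 0 := by
  classical
  let A := MonoidAlgebra k G
  let M := ∀ i, (X i).asModule
  have hoff (f : End A M) (i j : ι) (hij : i ≠ j) (v : (X i).asModule) :
      f (Pi.single i v) j = 0 := by
    have := hne i j hij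
    have := hX i
    have := hX j
    let φ : (X i).asModule →ₗ[A] (X j).asModule :=
      LinearMap.proj j ∘ₗ f ∘ₗ LinearMap.single A (fun i => (X i).asModule) i
    have hφ : φ = 0 := by
      rw [← LinearEquiv.map_eq_zero_iff
        (Representation.IntertwiningMap.equivLinearMapAsModule (X i) (X j)).symm]
      exact Subsingleton.elim _ _
    exact LinearMap.congr_fun hφ v
  have hdiag (f : End A M) (i : ι) : ∃ c : k, ∀ v : (X i).asModule,
      f (Pi.single i v) i = c • v := by
    have := hX i
    let φ : End A (X i).asModule :=
      LinearMap.proj i ∘ₗ f ∘ₗ LinearMap.single A (fun i => (X i).asModule) i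
    obtain ⟨c, hc⟩ := (IsSimpleModule.algebraMap_end_bijective_of_isAlgClosed k
      (A := A) (V := (X i).asModule)).2 φ
    exact ⟨c, fun v => (LinearMap.congr_fun hc v).symm⟩
  have hsum (f : End A M) (m : M) (i : ι) : f m i = f (Pi.single i (m i)) i := by
    conv_lhs => rw [← Finset.univ_sum_single m]
    rw [map_sum, Finset.sum_apply]
    exact Finset.sum_eq_single i (fun j _ hj => hoff f j i hj _) (by simp)
  let F : End (End A M) M :=
    { toFun := fun m => Pi.single i ((X i).asModuleEquiv.symm (T ((X i).asModuleEquiv (m i))))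
      map_add' := fun a b => by rw [Pi.add_apply, map_add, map_add, map_add, Pi.single_add]
      map_smul' := fun f m => by
        obtain ⟨c, hc⟩ := hdiag f i
        funext j
        simp only [Module.End.smul_def, RingHom.id_apply]
        rw [hsum f m i, hc]
        by_cases hj : j = i
        · subst hj
          rw [hc]
          simp
        · rw [hoff f i j (Ne.symm hj), Pi.single_eq_of_ne hj] }
  have hss : IsSemisimpleModule A M := by
    have (i : ι) : IsSimpleModule A (X i).asModule := by
      have := hX i
      infer_instance
    infer_instance
  obtain ⟨r, hr⟩ := jacobson_density F (Finset.univ.biUnion fun j =>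
    Finset.univ.image fun l => (Pi.single j ((X j).asModuleEquiv.symm (finBasis k (V j) l)) : M))
  have hr' (j l) := hr (Pi.single j ((X j).asModuleEquiv.symm (finBasis k (V j) l)))
    (Finset.mem_biUnion.mpr ⟨j, Finset.mem_univ _, Finset.mem_image_of_mem _ (Finset.mem_univ l)⟩)
  have hr2 (j l) : (X j).asAlgebraHom r (finBasis k (V j) l) = (X j).asModuleEquiv
      (F (Pi.single j ((X j).asModuleEquiv.symm (finBasis k (V j) l))) j) := by
    rw [hr' j l, Pi.smul_apply, Pi.single_eq_same, Representation.asModuleEquiv_map_smul]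
    simp
  refine ⟨r, (finBasis k (V i)).ext fun l => ?_, fun j hj => (finBasis k (V j)).ext fun l => ?_⟩
  · rw [hr2]
    simp [F]
  · rw [hr2]
    simp [F, hj]

/-- Evaluate a relation at a group algebra element acting on V i with trace 1 and on the other V j
as zero. A rank-one idempotent is used because dim V i may vanish in k. -/
theorem linearIndependent_character (X : ∀ i, Representation k G (V i))
    (hX : ∀ i, (X i).IsIrreducible) (hne : ∀ i j, i ≠ j → IsEmpty ((X i).Equiv (X j))) :
    LinearIndependent k fun i => (X i).character := by
  have htr (i) (r : MonoidAlgebra k G) : LinearMap.trace k (V i) ((X i).asAlgebraHom r) =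
      ∑ g ∈ r.coeff.support, r.coeff g * (X i).character g := by
    rw [Representation.asAlgebraHom_def, MonoidAlgebra.lift_apply, Finsupp.sum, map_sum]
    simp [Representation.character]
  rw [Fintype.linearIndependent_iff]
  intro c hc i
  have hfr : 0 < finrank k (V i) := by
    have : IsSimpleModule (MonoidAlgebra k G) (X i).asModule := by
      have := hX i
      infer_instance
    have := IsSimpleModule.nontrivial (MonoidAlgebra k G) (X i).asModule
    have : Nontrivial (V i) := (X i).asModuleEquiv.symm.toEquiv.nontrivial
    exact finrank_pos
  let b := finBasis k (V i)
  let T : End k (V i) := Matrix.toLin b b (Matrix.single ⟨0, hfr⟩ ⟨0, hfr⟩ 1)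
  have hT : LinearMap.trace k (V i) T = 1 := by
    rw [LinearMap.trace_eq_matrix_trace k b, LinearMap.toMatrix_toLin, Matrix.trace_single_eq_same]
  obtain ⟨r, hr, hr0⟩ := exists_asAlgebraHom_eq X hX hne i T
  have h0 : ∑ j, c j * LinearMap.trace k (V j) ((X j).asAlgebraHom r) = 0 := by
    simp_rw [htr, Finset.mul_sum]
    rw [Finset.sum_comm]
    refine Finset.sum_eq_zero fun g _ => ?_
    have := congrFun hc g
    simp only [Finset.sum_apply, Pi.smul_apply, smul_eq_mul, Pi.zero_apply] at this
    calc _ = r.coeff g * ∑ j, c j * (X j).character g := by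
          rw [Finset.mul_sum]
          exact Finset.sum_congr rfl fun j _ => by ring
      _ = 0 := by rw [this, mul_zero]
  rwa [Finset.sum_eq_single i (fun j _ hj => by rw [hr0 j hj, map_zero, mul_zero]) (by simp), hr,
    hT, mul_one] at h0

end density

instance : IsAlgClosed K := (algebraicClosure.isAlgClosure ℚ ℂ).isAlgClosed

theorem trace_eq_sum_roots {k V : Type*} [Field k] [IsAlgClosed k] [AddCommGroup V] [Module k V]
    [FiniteDimensional k V] (e : End k V) : LinearMap.trace k V e = e.charpoly.roots.sum :=
  Module.End.trace_eq_sum_roots_charpoly_of_splits (IsAlgClosed.splits _)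

/-! ### Completeness of the irreducible characters in characteristic zero. -/

section completeness

variable {k G : Type*} [Field k] [IsAlgClosed k] [CharZero k] [Group G] [Fintype G]

/-- Since f is a class function the operator is an intertwiner, hence a scalar; its trace is zero
and dim V is invertible. -/
theorem sum_smul_eq_zero_of_orthogonal {V : Type*} [AddCommGroup V] [Module k V]
    [FiniteDimensional k V] (f : G → k) (hf : ∀ g h, f (h * g * h⁻¹) = f g)
    (X : Representation k G V) (hX : X.IsIrreducible) (h0 : ∑ g, f g * X.character g⁻¹ = 0) :
    ∑ g, f g • X g⁻¹ = 0 := by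
  let S : X.IntertwiningMap X :=
    { toLinearMap := ∑ g, f g • X g⁻¹
      isIntertwining' := fun h => by
        rw [← Module.End.mul_eq_comp, ← Module.End.mul_eq_comp, Finset.sum_mul, Finset.mul_sum]
        refine Fintype.sum_equiv (MulAut.conj h⁻¹).toEquiv _ _ fun g => ?_
        simp only [MulEquiv.toEquiv_eq_coe, MulEquiv.coe_toEquiv, MulAut.conj_apply, hf,
          smul_mul_assoc, mul_smul_comm, ← map_mul]
        congr 2
        group }
  obtain ⟨c, hc⟩ :=
    (Representation.IsIrreducible.algebraMap_intertwiningMap_bijective_of_isAlgClosed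
      (ρ := X)).2 S
  have hS : ∑ g, f g • X g⁻¹ = c • (1 : End k V) :=
    (congrArg Representation.IntertwiningMap.toLinearMap hc).symm
  have htr := congrArg (LinearMap.trace k V) hS
  rw [map_sum, map_smul, LinearMap.trace_one] at htr
  simp only [map_smul, smul_eq_mul] at htr
  have hV : (finrank k V : k) ≠ 0 := by
    have : IsSimpleModule (MonoidAlgebra k G) X.asModule := by
      infer_instance
    have := IsSimpleModule.nontrivial (MonoidAlgebra k G) X.asModule
    have : Nontrivial V := X.asModuleEquiv.symm.toEquiv.nontrivial
    exact_mod_cast finrank_pos.ne'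
  have hc0 : c = 0 := by
    refine (mul_eq_zero.mp (htr.symm.trans ?_)).resolve_right hV
    exact h0
  rw [hS, hc0, zero_smul]

/-- The left regular representation on the space of functions. -/
def regularRep (k G : Type*) [Field k] [Group G] : Representation k G (G → k) where
  toFun g := LinearMap.funLeft k k fun x => g⁻¹ * x
  map_one' := by ext; simp
  map_mul' g h := by ext; simp [LinearMap.funLeft_apply, mul_assoc]

omit [IsAlgClosed k] [CharZero k] in
theorem character_regularRep [DecidableEq G] (g : G) :
    (regularRep k G).character g = if g = 1 then (Fintype.card G : k) else 0 := by
  rw [Representation.character, LinearMap.trace_eq_matrix_trace k (Pi.basisFun k G), Matrix.trace]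
  simp only [Matrix.diag_apply, LinearMap.toMatrix_apply, Pi.basisFun_apply, Pi.basisFun_repr]
  change ∑ x, (Pi.single x 1 : G → k) (g⁻¹ * x) = _
  simp only [Pi.single_apply, mul_eq_right, inv_eq_one]
  split_ifs <;> simp

theorem eq_zero_of_orthogonal (f : G → k) (hf : ∀ g h, f (h * g * h⁻¹) = f g)
    (h0 : ∀ (n : ℕ) (X : Representation k G (Fin n → k)), X.IsIrreducible →
      ∑ g, f g * X.character g⁻¹ = 0) : f = 0 := by
  classical
  -- Functions annihilated by convolution with f. They include the irreducible characters, hence all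
  -- characters, and the regular character then gives |G| f = 0.
  let C : AddSubmonoid (G → k) :=
    { carrier := {u | ∀ h, ∑ g, f g * u (g⁻¹ * h) = 0}
      zero_mem' := fun h => by simp
      add_mem' := fun {a b} ha hb h => by
        simp only [Pi.add_apply, mul_add, Finset.sum_add_distrib]
        rw [ha h, hb h, add_zero] }
  have key := charpoly_invariant_mem (k := k) (G := G) (fun _ P => P.roots.sum) (by simp)
    (fun g P Q hP hQ => by
      rw [Polynomial.roots_mul (mul_ne_zero hP.ne_zero hQ.ne_zero), Multiset.sum_add]) C
    (fun n X hX h => by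
      simp only [← trace_eq_sum_roots]
      have := congrArg (fun e => LinearMap.trace k _ (e * X h))
        (sum_smul_eq_zero_of_orthogonal f hf X hX (h0 n X hX))
      simpa [Finset.sum_mul, map_sum, ← map_mul] using this)
  obtain ⟨X, hX⟩ := exists_coordinate_representation (regularRep k G)
  funext h
  have := key _ X h
  simp only [hX, ← trace_eq_sum_roots] at this
  change ∑ g, f g * (regularRep k G).character (g⁻¹ * h) = 0 at this
  simp only [character_regularRep, inv_mul_eq_one] at this
  simpa using this

end completeness

/-! ### Ordinary characters and their inner products. -/

theorem character_inv_eq_conj {G : Type*} [Group G] [Fintype G] {n : ℕ}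
    (X : Representation K G (Fin n → K)) (g : G) :
    ((X.character g⁻¹ : K) : ℂ) = starRingEnd ℂ (X.character g : K) := by
  let M : G →* Matrix (Fin n) (Fin n) ℂ :=
    { toFun := fun g => (LinearMap.toMatrix' (X g)).map (algebraMap K ℂ)
      map_one' := by
        rw [map_one, LinearMap.toMatrix'_one]
        exact Matrix.map_one _ (map_zero _) (map_one _)
      map_mul' := fun a b => by simp [LinearMap.toMatrix'_mul, Matrix.map_mul] }
  have hM (g : G) : (M g).trace = ((X.character g : K) : ℂ) := by
    change Matrix.trace ((LinearMap.toMatrix' (X g)).map (algebraMap K ℂ)) = _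
    rw [← AddMonoidHom.map_trace, Representation.character,
      LinearMap.trace_eq_matrix_trace K (Pi.basisFun K (Fin n))]
    rfl
  -- Averaging gives a G-invariant positive definite form, so M g⁻¹ is conjugate to the adjoint of M
  -- g.
  let P := ∑ h, (M h).conjTranspose * M h
  have hP : P.PosDef := by
    refine Matrix.posDef_sum ⟨1, Finset.mem_univ _⟩ fun h _ =>
      Matrix.PosDef.conjTranspose_mul_self _ fun u v huv => ?_
    have := congrArg (M h⁻¹).mulVec huv
    simpa [Matrix.mulVec_mulVec, ← map_mul] using this
  have hinv : (M g).conjTranspose * P * M g = P := by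
    simp only [P, Finset.mul_sum, Finset.sum_mul]
    refine Fintype.sum_equiv (Equiv.mulRight g) _ _ fun h => ?_
    simp [Matrix.conjTranspose_mul, Matrix.mul_assoc]
  have hu : P * P⁻¹ = 1 := Matrix.mul_nonsing_inv _ ((Matrix.isUnit_iff_isUnit_det _).mp hP.isUnit)
  have hgg : M g * M g⁻¹ = 1 := by rw [← map_mul, mul_inv_cancel, map_one]
  have h1 : (M g).conjTranspose * P = P * M g⁻¹ := by
    calc _ = (M g).conjTranspose * P * (M g * M g⁻¹) := by rw [hgg, mul_one]
      _ = _ := by rw [← mul_assoc, hinv]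
  rw [← hM, ← hM]
  calc (M g⁻¹).trace = (P * M g⁻¹ * P⁻¹).trace := by
        rw [Matrix.trace_mul_comm, ← mul_assoc, mul_eq_one_comm.mp hu, one_mul]
    _ = (M g).conjTranspose.trace := by rw [← h1, mul_assoc, hu, mul_one]
    _ = _ := by rw [Matrix.trace_conjTranspose]; rfl

section Irr

variable {G : Type*} [Group G]

theorem exists_irr_representations (G : Type*) [Group G] :
    ∃ (n : Irr G → ℕ) (X : ∀ χ : Irr G, Representation K G (Fin (n χ) → K)),
      (∀ χ, (X χ).IsIrreducible) ∧ (∀ (χ : Irr G) g, (χ : G → ℂ) g = ((X χ).character g : K)) ∧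
      ∀ χ ψ, χ ≠ ψ → IsEmpty ((X χ).Equiv (X ψ)) := by
  choose n X hX hχ using fun χ : Irr G => χ.2
  refine ⟨n, X, hX, fun χ g => congrFun (hχ χ) g, fun χ ψ h => ⟨fun e => h (Subtype.ext ?_)⟩⟩
  rw [hχ χ, hχ ψ, Representation.char_iso e]

theorem finite_irr [Finite G] : Finite (Irr G) := by
  classical
  obtain ⟨n, X, hX, -, hne⟩ := exists_irr_representations G
  have hli : LinearIndependent K fun χ : Irr G => (X χ).character := by
    rw [linearIndependent_iff_finset_linearIndependent]
    intro s
    exact linearIndependent_character (fun χ : s => X χ) (fun χ => hX χ)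
      fun i j hij => hne i j fun h => hij (Subtype.ext h)
  exact hli.finite

/-- Class functions are expanded in terms of irreducible characters by their inner products. -/
theorem exists_irr_expansion [Fintype G] [Fintype (Irr G)] (θ : G → K)
    (hθ : ∀ g h, θ (h * g * h⁻¹) = θ g) :
    ∃ a : Irr G → K, (∀ χ : Irr G, (a χ : ℂ) = charInner (fun g => (θ g : ℂ)) χ) ∧
      ∀ g, (θ g : ℂ) = ∑ χ : Irr G, (a χ : ℂ) * (χ : G → ℂ) g := by
  classical
  obtain ⟨n, X, hX, hχ, hne⟩ := exists_irr_representations G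
  have hc : (Nat.card G : K) ≠ 0 := by exact_mod_cast Nat.card_pos.ne'
  have : Invertible (Nat.card G : K) := invertibleOfNonzero hc
  let a : Irr G → K := fun χ => (Nat.card G : K)⁻¹ * ∑ g, θ g * (X χ).character g⁻¹
  have horth (χ ψ : Irr G) :
      ∑ g, (X χ).character g * (X ψ).character g⁻¹ = if χ = ψ then (Nat.card G : K) else 0 := by
    have := hX χ
    have := hX ψ
    have h := Representation.char_orthonormal (X χ) (X ψ)
    rw [inv_mul_eq_iff_eq_mul₀ hc] at h
    rw [h]
    by_cases hχψ : χ = ψ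
    · subst hχψ
      simp [show Nonempty ((X χ).Equiv (X χ)) from ⟨.refl _⟩]
    · simp [hne ψ χ (Ne.symm hχψ), hχψ]
  have hf := eq_zero_of_orthogonal (fun g => θ g - ∑ χ, a χ * (X χ).character g)
    (fun g h => by simp only [hθ, Representation.char_conj]) (fun m Y hY => by
      have hY' : (fun g => ((Y.character g : K) : ℂ)) ∈ Irr G := ⟨m, Y, hY, rfl⟩
      have hYX (g : G) : Y.character g = (X ⟨_, hY'⟩).character g :=
        Subtype.ext (hχ ⟨_, hY'⟩ g)
      simp only [hYX, sub_mul, Finset.sum_sub_distrib, Finset.sum_mul]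
      rw [Finset.sum_comm]
      simp only [mul_assoc, ← Finset.mul_sum, horth]
      simp [a, mul_comm])
  refine ⟨a, fun χ => ?_, fun g => ?_⟩
  · simp only [charInner, hχ, ← character_inv_eq_conj, a]
    simp
  · have := congrFun hf g
    simp only [Pi.zero_apply, sub_eq_zero] at this
    rw [this]
    simp [hχ]

end Irr

/-! ### Roots of unity, the residue field and a valuation ring above I. -/

theorem exists_eq_of_pow_eq_one {m : ℕ} {z : K} (hm : 0 < m) (hz : z ^ m = 1) :
    ∃ r : R, (r : K) = z ∧ r ^ m = 1 := by
  have hint : IsIntegral ℤ z := IsIntegral.of_pow hm (hz ▸ isIntegral_one)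
  exact ⟨⟨z, hint⟩, rfl, Subtype.ext hz⟩

section residue

variable {p : ℕ} {I : Ideal R} [I.IsMaximal]

theorem natCast_notMem_of_coprime (hI : (p : R) ∈ I) {m : ℕ} (hm : p.Coprime m) :
    (m : R) ∉ I := by
  intro h
  apply Ideal.IsPrime.ne_top (I := I) inferInstance
  rw [Ideal.eq_top_iff_one]
  have := Nat.isCoprime_iff_coprime.mpr hm
  obtain ⟨a, b, hab⟩ := this
  have h1 : (a : R) * p + b * m = 1 := by exact_mod_cast congrArg (Int.cast : ℤ → R) hab
  rw [← h1]
  exact I.add_mem (I.mul_mem_left _ hI) (I.mul_mem_left _ h)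

theorem mk_injOn_roots (hI : (p : R) ∈ I) {m : ℕ} (hm0 : 0 < m) (hm : p.Coprime m) :
    Set.InjOn (Ideal.Quotient.mk I) {z : R | z ^ m = 1} := by
  intro z hz w hw hzw
  have hz : z ^ m = 1 := hz
  have hw : w ^ m = 1 := hw
  have hw1 : w ^ (m - 1) * w = 1 := by rw [← pow_succ, Nat.sub_add_cancel hm0, hw]
  by_contra hne
  -- u = z/w is an m-th root of unity other than 1, so its geometric sum vanishes; modulo I that sum
  -- is m.
  let u := z * w ^ (m - 1)
  have hu : u ^ m = 1 := by rw [mul_pow, hz, one_mul, ← pow_mul, mul_comm, pow_mul, hw, one_pow]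
  have hu1 : u ≠ 1 := fun h => hne <| by
    calc z = z * (w ^ (m - 1) * w) := by rw [hw1, mul_one]
      _ = u * w := by ring
      _ = w := by rw [h, one_mul]
  have hmu : Ideal.Quotient.mk I u = 1 := by
    rw [map_mul, hzw, ← map_mul, mul_comm, hw1, map_one]
  have hsum : ∑ i ∈ Finset.range m, u ^ i = 0 := by
    have := geom_sum_mul u m
    rw [hu, sub_self] at this
    exact (mul_eq_zero.mp this).resolve_right (sub_ne_zero.mpr hu1)
  apply natCast_notMem_of_coprime hI hm
  rw [← Ideal.Quotient.eq_zero_iff_mem]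
  have := congrArg (Ideal.Quotient.mk I) hsum
  simpa [hmu] using this

/-- A primitive m-th root of unity lies in R and stays primitive modulo I by injectivity, so its
powers exhaust the m-th roots of unity of F. -/
theorem exists_root_lift (hI : (p : R) ∈ I) {m : ℕ} (hm0 : 0 < m) (hm : p.Coprime m) (y : F I)
    (hy : y ^ m = 1) : ∃ z : R, z ^ m = 1 ∧ Ideal.Quotient.mk I z = y := by
  have : NeZero m := ⟨hm0.ne'⟩
  have : NeZero (m : K) := ⟨by exact_mod_cast hm0.ne'⟩
  obtain ⟨ζ, hζ⟩ := HasEnoughRootsOfUnity.exists_primitiveRoot K m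
  obtain ⟨r, rfl, hr⟩ := exists_eq_of_pow_eq_one hm0 hζ.pow_eq_one
  have hr' : IsPrimitiveRoot (Ideal.Quotient.mk I r) m := by
    refine ⟨by rw [← map_pow, hr, map_one], fun l hl => hζ.dvd_of_pow_eq_one l ?_⟩
    have h1 : r ^ l = 1 := mk_injOn_roots hI hm0 hm
      (by rw [Set.mem_ofPred_eq, ← pow_mul, mul_comm, pow_mul, hr, one_pow]) (one_pow m)
      (by rw [map_pow, hl, map_one])
    exact_mod_cast congrArg (Subtype.val : R → K) h1
  obtain ⟨i, -, hi⟩ := hr'.eq_pow_of_pow_eq_one hy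
  exact ⟨r ^ i, by rw [← pow_mul, mul_comm, pow_mul, hr, one_pow], by rw [map_pow, hi]⟩

instance : IsAlgClosed (F I) := by
  refine IsAlgClosed.of_exists_root _ fun P hP hirr => ?_
  have hlift : P ∈ Polynomial.lifts (Ideal.Quotient.mk I) :=
    (Polynomial.mem_lifts _).mpr (Polynomial.map_surjective _ Ideal.Quotient.mk_surjective P)
  obtain ⟨Q, hQP, hdeg, hQ⟩ := Polynomial.lifts_and_natDegree_eq_and_monic hlift hP
  have hQdeg : (Q.map (algebraMap R K)).degree ≠ 0 := by
    rw [hQ.degree_map, Polynomial.degree_eq_natDegree hQ.ne_zero, hdeg]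
    exact_mod_cast hirr.natDegree_pos.ne'
  obtain ⟨x, hx⟩ := IsAlgClosed.exists_root _ hQdeg
  have hxR : IsIntegral R x := ⟨Q, hQ, by rwa [Polynomial.IsRoot, Polynomial.eval_map] at hx⟩
  let r : R := ⟨x, isIntegral_trans x hxR⟩
  have hr : Q.eval r = 0 := by
    apply Subtype.val_injective
    change algebraMap R K (Q.eval r) = 0
    rw [← Polynomial.eval₂_at_apply]
    rwa [Polynomial.IsRoot, Polynomial.eval_map] at hx
  refine ⟨Ideal.Quotient.mk I r, ?_⟩
  rw [← hQP, Polynomial.eval_map, Polynomial.eval₂_at_apply, hr, map_zero]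

/-- The field `K` has a valuation ring that contains `R` and whose residue class field is `F`. -/
theorem exists_valuationSubring (hp : p.Prime) (hI : (p : R) ∈ I) :
    ∃ (V : ValuationSubring K) (red : V →+* F I),
      ∀ r : R, ∃ h : (r : K) ∈ V, red ⟨r, h⟩ = Ideal.Quotient.mk I r := by
  let f : Localization.AtPrime I →+* K := IsLocalization.lift (M := I.primeCompl)
    (g := algebraMap R K) (fun y => by
      rw [isUnit_iff_ne_zero, Ne, FaithfulSMul.algebraMap_eq_zero_iff]
      rintro h
      exact y.2 (h ▸ I.zero_mem))
  -- V dominates the localization of R at I, so F embeds in the residue field of V.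
  obtain ⟨V, hV, hloc⟩ := IsLocalRing.exists_factor_valuationRing f
  have hRV (r : R) : (r : K) ∈ V := by
    have := hV (algebraMap R _ r)
    simpa [f] using this
  let φ : R →+* V := (algebraMap R K).codRestrict V.toSubring hRV
  let ψ : R →+* IsLocalRing.ResidueField V := (IsLocalRing.residue V).comp φ
  have hψ (r : R) (hr : r ∈ I) : ψ r = 0 := by
    rw [RingHom.comp_apply, IsLocalRing.residue_eq_zero_iff, IsLocalRing.mem_maximalIdeal,
      mem_nonunits_iff]
    intro hu
    have hu' : IsUnit (f.codRestrict V.toSubring hV (algebraMap R _ r)) := by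
      have he : f.codRestrict V.toSubring hV (algebraMap R _ r) = φ r :=
        Subtype.ext (by simp [f, φ]; rfl)
      rw [he]
      exact hu
    have := hloc.map_nonunit _ hu'
    rw [IsLocalization.AtPrime.isUnit_to_map_iff _ I] at this
    exact this hr
  let E : F I →+* IsLocalRing.ResidueField V := Ideal.Quotient.lift I ψ hψ
  let _ : Algebra (F I) (IsLocalRing.ResidueField V) := E.toAlgebra
  -- An element of V is a root of a primitive integral polynomial, which stays nonzero modulo p. So
  -- its residue is algebraic over the algebraically closed field F.
  have hintg : Algebra.IsIntegral (F I) (IsLocalRing.ResidueField V) := by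
    refine ⟨fun y => IsAlgebraic.isIntegral ?_⟩
    obtain ⟨x, rfl⟩ := IsLocalRing.residue_surjective y
    have hx : IsAlgebraic ℤ (x : K) := by
      rw [IsFractionRing.isAlgebraic_iff ℤ ℚ K]
      exact (algebraicClosure.isAlgebraic ℚ ℂ).isAlgebraic _
    obtain ⟨P, hP0, hP⟩ := hx
    have hprim : Polynomial.aeval (x : K) P.primPart = 0 := by
      rw [P.eq_C_content_mul_primPart, map_mul] at hP
      refine (mul_eq_zero.mp hP).resolve_left ?_
      simpa [Polynomial.content_eq_zero_iff] using hP0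
    have hx0 : Polynomial.aeval x P.primPart = 0 := by
      apply Subtype.val_injective
      change V.subtype (Polynomial.aeval x P.primPart) = 0
      rw [← hprim, Polynomial.aeval_def, Polynomial.hom_eval₂, Polynomial.aeval_def]
      congr 1
    have hpF : ((p : ℤ) : F I) = 0 := by
      have := Ideal.Quotient.eq_zero_iff_mem.mpr hI
      exact_mod_cast this
    refine ⟨P.primPart.map (Int.castRingHom (F I)), fun h0 => ?_, ?_⟩
    · have hdvd : Polynomial.C (p : ℤ) ∣ P.primPart := by
        rw [Polynomial.C_dvd_iff_dvd_coeff]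
        intro i
        by_contra hni
        have hco : IsCoprime (p : ℤ) (P.primPart.coeff i) :=
          (Nat.prime_iff_prime_int.mp hp).coprime_iff_not_dvd.mpr hni
        obtain ⟨a, b, hab⟩ := hco
        have hc : ((P.primPart.coeff i : ℤ) : F I) = 0 := by
          simpa using congrArg (fun Q => Polynomial.coeff Q i) h0
        have := congrArg (Int.cast : ℤ → F I) hab
        rw [Int.cast_add, Int.cast_mul, Int.cast_mul, hpF, hc] at this
        simp at this
      exact (Nat.prime_iff_prime_int.mp hp).not_isUnit (P.isPrimitive_primPart _ hdvd)
    · rw [Polynomial.aeval_def, Polynomial.eval₂_map,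
        RingHom.ext_int ((algebraMap (F I) _).comp _)
          ((IsLocalRing.residue V).comp (algebraMap ℤ V)),
        ← Polynomial.hom_eval₂, ← Polynomial.aeval_def, hx0, map_zero]
  have hbij : Function.Bijective E := IsAlgClosed.algebraMap_bijective_of_isIntegral
  let e := RingEquiv.ofBijective E hbij
  refine ⟨V, (e.symm : _ →+* F I).comp (IsLocalRing.residue V), fun r => ⟨hRV r, ?_⟩⟩
  rw [RingHom.comp_apply]
  change e.symm _ = _
  rw [RingEquiv.symm_apply_eq]
  rfl

end residue

/-! ### Regular elements, eigenvalues and Frobenius powers. -/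

section regular

variable {G : Type*} [Group G] [Finite G] {p : ℕ}

variable (G p) in
/-- The largest divisor of `|G|` that is prime to `p`. -/
def primePart : ℕ := Nat.card G / p ^ (Nat.card G).factorization p

variable (G) in
theorem coprime_primePart (hp : p.Prime) : p.Coprime (primePart G p) :=
  Nat.coprime_ordCompl hp Nat.card_pos.ne'

variable (G p) in
theorem primePart_pos : 0 < primePart G p := Nat.ordCompl_pos _ Nat.card_pos.ne'

theorem not_dvd_orderOf_iff (hp : p.Prime) (g : G) :
    ¬ p ∣ orderOf g ↔ g ^ primePart G p = 1 := by
  rw [← orderOf_dvd_iff_pow_eq_one]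
  constructor
  · intro h
    have h1 : orderOf g ∣ p ^ (Nat.card G).factorization p * primePart G p := by
      rw [primePart, Nat.ordProj_mul_ordCompl_eq_self]
      exact orderOf_dvd_natCard g
    exact (((Nat.Prime.coprime_iff_not_dvd hp).mpr h).symm.pow_right _).dvd_of_dvd_mul_left h1
  · intro h hpg
    exact (Nat.Prime.coprime_iff_not_dvd hp).mp (coprime_primePart G hp) (hpg.trans h)

theorem not_dvd_orderOf_pow (hp : p.Prime) (g : G) :
    ¬ p ∣ orderOf (g ^ p ^ (Nat.card G).factorization p) := by
  rw [not_dvd_orderOf_iff hp, ← pow_mul, primePart, Nat.ordProj_mul_ordCompl_eq_self,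
    pow_card_eq_one']

end regular

theorem pow_eq_one_of_mem_roots_charpoly {k V : Type*} [Field k] [AddCommGroup V] [Module k V]
    [FiniteDimensional k V] {e : End k V} {m : ℕ} (he : e ^ m = 1) {z : k}
    (hz : z ∈ e.charpoly.roots) : z ^ m = 1 := by
  have hev : e.HasEigenvalue z :=
    (Module.End.hasEigenvalue_iff_isRoot_charpoly e z).mpr (Polynomial.isRoot_of_mem_roots hz)
  obtain ⟨v, hv⟩ := hev.exists_hasEigenvector
  have := hv.pow_apply m
  rw [he, Module.End.one_apply] at this
  have h2 : (z ^ m - 1) • v = 0 := by rw [sub_smul, ← this, one_smul, sub_self]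
  exact sub_eq_zero.mp ((smul_eq_zero.mp h2).resolve_right hv.2)

/-- With q = p ^ a, substitute X ^ q for X: then X ^ q - M ^ q = (X - M) ^ q, and determinants are
multiplicative. -/
theorem charpoly_matrix_pow {k n : Type*} [Field k] [Fintype n] [DecidableEq n] (p : ℕ)
    [Fact p.Prime] [CharP k p] (M : Matrix n n k) (a : ℕ) :
    (M ^ p ^ a).charpoly = M.charpoly.map (iterateFrobenius k p a) := by
  cases isEmpty_or_nonempty n
  · simp [Matrix.charpoly]
  have hq : 0 < p ^ a := pow_pos (Fact.out : p.Prime).pos a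
  apply Polynomial.expand_injective hq
  rw [← Polynomial.map_expand, Polynomial.map_iterateFrobenius_expand]
  unfold Matrix.charpoly
  rw [AlgHom.map_det, ← Matrix.coe_detMonoidHom,
    ← (Matrix.detMonoidHom : Matrix n n k[X] →* k[X]).map_pow]
  apply congr_arg Matrix.det
  refine matPolyEquiv.injective ?_
  rw [map_pow, Matrix.matPolyEquiv_charmatrix, sub_pow_char_pow_of_commute, ← C_pow]
  · exact (id (matPolyEquiv_eq_X_pow_sub_C (p ^ a) M) :)
  · exact (C M).commute_X

theorem trace_pow_char {k V : Type*} [Field k] [AddCommGroup V] [Module k V]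
    [FiniteDimensional k V] (p : ℕ) [Fact p.Prime] [CharP k p] (e : End k V) (a : ℕ) :
    LinearMap.trace k V (e ^ p ^ a) = LinearMap.trace k V e ^ p ^ a := by
  rw [LinearMap.trace_eq_matrix_trace k (finBasis k V),
    LinearMap.trace_eq_matrix_trace k (finBasis k V), ← LinearMap.toMatrix_pow,
    Matrix.trace_eq_neg_charpoly_nextCoeff, Matrix.trace_eq_neg_charpoly_nextCoeff,
    charpoly_matrix_pow, Polynomial.nextCoeff_map (RingHom.injective _), ← iterateFrobenius_def,
    map_neg]

theorem charpoly_apply_conj {k G V : Type*} [Field k] [Group G] [AddCommGroup V] [Module k V]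
    [FiniteDimensional k V] (X : Representation k G V) (g h : G) :
    (X (h * g * h⁻¹)).charpoly = (X g).charpoly := by
  have hinv (a b : G) (hab : a * b = 1) : X a ∘ₗ X b = LinearMap.id := by
    rw [← Module.End.mul_eq_comp, ← map_mul, hab, map_one]
    rfl
  let e : V ≃ₗ[k] V := LinearEquiv.ofLinearMap (X h) (X h⁻¹) (hinv _ _ (by simp))
    (hinv _ _ (by simp))
  rw [← LinearEquiv.charpoly_conj e (X g), map_mul, map_mul]
  rfl

/-! ### Brauer characters and their linear independence. -/

section Brauer

variable {G : Type*} [Group G] [Finite G] {p : ℕ} {I : Ideal R} [I.IsMaximal]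

theorem rootLift_mk (hp : p.Prime) (hI : (p : R) ∈ I) {z : R} (hz : z ^ primePart G p = 1) :
    rootLift G p I (Ideal.Quotient.mk I z) = z :=
  (mk_injOn_roots hI (primePart_pos G p) (coprime_primePart G hp)).leftInvOn_invFunOn hz

theorem mk_rootLift (hp : p.Prime) (hI : (p : R) ∈ I) {y : F I} (hy : y ^ primePart G p = 1) :
    Ideal.Quotient.mk I (rootLift G p I y) = y := by
  obtain ⟨z, hz, rfl⟩ := exists_root_lift hI (primePart_pos G p) (coprime_primePart G hp) y hy
  rw [rootLift_mk hp hI hz]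

omit [Finite G] in
variable (p) in
/-- Brauer characters with values in `R`. -/
def brauerR {n : ℕ} (X : Representation (F I) G (Fin n → F I)) (g : G) : R :=
  if p ∣ orderOf g then 0 else ((X g).charpoly.roots.map (rootLift G p I)).sum

omit [Finite G] in
theorem brauerCharacter_apply {n : ℕ} (X : Representation (F I) G (Fin n → F I)) (g : G) :
    brauerCharacter p I X g = ((brauerR p X g : K) : ℂ) := by
  rw [brauerCharacter, restr, brauerR]
  split_ifs
  · simp
  · let c : R →+ ℂ := ((algebraMap K ℂ).comp (algebraMap R K) : R →+* ℂ)
    change _ = c _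
    rw [map_multiset_sum, Multiset.map_map]
    rfl

omit [Finite G] in
theorem brauerR_conj {n : ℕ} (X : Representation (F I) G (Fin n → F I)) (g h : G) :
    brauerR p X (h * g * h⁻¹) = brauerR p X g := by
  have h1 : orderOf (h * g * h⁻¹) = orderOf g := (MulAut.conj h).orderOf_eq g
  have h2 : (X (h * g * h⁻¹)).charpoly = (X g).charpoly :=
    charpoly_apply_conj X g h
  rw [brauerR, brauerR, h1, h2]

theorem mk_brauerR (hp : p.Prime) (hI : (p : R) ∈ I) {n : ℕ}
    (X : Representation (F I) G (Fin n → F I)) {g : G} (hg : ¬ p ∣ orderOf g) :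
    Ideal.Quotient.mk I (brauerR p X g) = X.character g := by
  have hXg : X g ^ primePart G p = 1 := by
    rw [← map_pow, (not_dvd_orderOf_iff hp g).mp hg, map_one]
  rw [brauerR, if_neg hg, map_multiset_sum, Multiset.map_map, Representation.character,
    trace_eq_sum_roots]
  congr 1
  conv_rhs => rw [← Multiset.map_id (X g).charpoly.roots]
  exact Multiset.map_congr rfl fun z hz =>
    mk_rootLift hp hI (pow_eq_one_of_mem_roots_charpoly hXg hz)

omit [Finite G] in
theorem brauerCharacter_mem_closure {n : ℕ} (X : Representation (F I) G (Fin n → F I)) :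
    brauerCharacter p I X ∈ AddSubmonoid.closure (IBr G p I) := by
  refine charpoly_invariant_mem (fun g P => if p ∣ orderOf g then (0 : ℂ) else
    (P.roots.map fun z => ((rootLift G p I z : K) : ℂ)).sum) (by simp)
    (fun g P Q hP hQ => ?_) (AddSubmonoid.closure (IBr G p I))
    (fun m Y hY => AddSubmonoid.subset_closure ⟨m, Y, hY, rfl⟩) n X
  rw [Polynomial.roots_mul (mul_ne_zero hP.ne_zero hQ.ne_zero), Multiset.map_add,
    Multiset.sum_add]
  split_ifs <;> simp

theorem linearIndependent_IBr (hp : p.Prime) (hI : (p : R) ∈ I) :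
    LinearIndependent K fun φ : IBr G p I => (φ : G → ℂ) := by
  classical
  have : Fact p.Prime := ⟨hp⟩
  have : CharP (F I) p := by
    refine (CharP.charP_iff_prime_eq_zero hp).mpr ?_
    exact_mod_cast Ideal.Quotient.eq_zero_iff_mem.mpr hI
  choose n X hX hφ using fun φ : IBr G p I => φ.2
  have hne (φ ψ : IBr G p I) (h : φ ≠ ψ) : IsEmpty ((X φ).Equiv (X ψ)) := by
    refine ⟨fun e => h (Subtype.ext ?_)⟩
    rw [hφ φ, hφ ψ]
    funext g
    simp only [brauerCharacter, restr]
    rw [← Representation.Equiv.conj_apply_self g e, LinearEquiv.charpoly_conj]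
  obtain ⟨V, red, hred⟩ := exists_valuationSubring hp hI
  rw [linearIndependent_iff']
  intro s c hc
  by_contra! hcon
  obtain ⟨i₀, hi₀s, hi₀⟩ := hcon
  -- Dividing by a coefficient of largest valuation puts the relation over V and keeps it nontrivial
  -- modulo the maximal ideal.
  obtain ⟨i, his, hi⟩ := s.exists_max_image (fun φ => V.valuation (c φ)) ⟨i₀, hi₀s⟩
  have hci : c i ≠ 0 := by
    intro h
    have := hi i₀ hi₀s
    rw [h, map_zero, le_zero_iff, map_eq_zero] at this
    exact hi₀ this
  have hd (φ : s) : c φ / c i ∈ V := by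
    rw [← V.valuation_le_one_iff, map_div₀]
    exact div_le_one_of_le₀ (hi φ φ.2) zero_le
  let d : s → F I := fun φ => red ⟨c φ / c i, hd φ⟩
  have hdi : d ⟨i, his⟩ = 1 := by
    rw [← map_one red]
    exact congrArg red (Subtype.ext (div_self hci))
  -- Every g ^ q is p-regular, so the reduced relation holds there for the F-characters.
  let q := p ^ (Nat.card G).factorization p
  have hq : 0 < q := pow_pos hp.pos _
  have hsum (g : G) : ∑ φ : s, d φ * (X φ).character (g ^ q) = 0 := by
    have h1 : ∑ φ : s, c φ / c i * (brauerR p (X φ) (g ^ q) : K) = 0 := by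
      have h2 : ∑ φ : s, c φ * (brauerR p (X φ) (g ^ q) : K) = 0 := by
        apply (algebraMap K ℂ).injective
        rw [map_sum, map_zero]
        have := congrFun hc (g ^ q)
        rw [← Finset.sum_coe_sort, Finset.sum_apply] at this
        rw [← Pi.zero_apply (M := fun _ : G => ℂ) (g ^ q), ← this]
        refine Finset.sum_congr rfl fun φ _ => ?_
        rw [Pi.smul_apply, hφ φ, brauerCharacter_apply, map_mul]
        rfl
      calc _ = (c i)⁻¹ * ∑ φ : s, c φ * (brauerR p (X φ) (g ^ q) : K) := by
            rw [Finset.mul_sum]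
            exact Finset.sum_congr rfl fun φ _ => by ring
        _ = 0 := by rw [h2, mul_zero]
    have h3 : ∑ φ : s, (⟨c φ / c i, hd φ⟩ : V) *
        ⟨(brauerR p (X φ) (g ^ q) : K), (hred _).choose⟩ = 0 := by
      apply Subtype.val_injective
      rw [← V.coe_subtype, map_sum]
      exact h1
    have h4 := congrArg red h3
    rw [map_sum, map_zero] at h4
    rw [← h4]
    refine Finset.sum_congr rfl fun φ _ => ?_
    rw [map_mul, (hred _).choose_spec, mk_brauerR hp hI (X φ) (not_dvd_orderOf_pow hp g)]
  -- As traces satisfy tr X(g ^ q) = (tr X(g)) ^ q, the relation is the q-th power of ∑ e φ tr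
  -- X_φ(g). This gives a relation on all of G.
  choose e he using fun φ : s => IsAlgClosed.exists_pow_nat_eq (d φ) hq
  have hli := linearIndependent_character (fun φ : s => X φ) (fun φ => hX φ)
    fun i j hij => hne i j fun h => hij (Subtype.ext h)
  rw [Fintype.linearIndependent_iff] at hli
  have he0 := hli e (by
    funext g
    rw [Finset.sum_apply, Pi.zero_apply]
    refine (pow_eq_zero_iff hq.ne').mp ?_
    rw [sum_pow_char_pow, ← hsum g]
    refine Finset.sum_congr rfl fun φ _ => ?_
    rw [Pi.smul_apply, smul_eq_mul, mul_pow, he, Representation.character,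
      Representation.character, map_pow, trace_pow_char]) ⟨i, his⟩
  have := he ⟨i, his⟩
  rw [he0, zero_pow hq.ne', hdi] at this
  exact zero_ne_one this

end Brauer

/-! ### Reduction modulo I and decomposition numbers. -/

/-- A finite group representation over the field of fractions of a valuation ring can be written
over the valuation ring, up to change of basis. -/
theorem exists_integral_form {k G : Type*} [Field k] [Group G] [Finite G] (V : ValuationSubring k)
    {n : ℕ} (X : Representation k G (Fin n → k)) :
    ∃ (m : ℕ) (Y : G →* Matrix (Fin m) (Fin m) V),
      ∀ g, (X g).charpoly = (Y g).charpoly.map V.subtype := by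
  let L : Submodule V (Fin n → k) :=
    Submodule.span V (Set.range fun x : G × Fin n => X x.1 (Pi.single x.2 1))
  have hfg : L.FG := Submodule.fg_span (Set.finite_range _)
  have hLX (g : G) (v : Fin n → k) (hv : v ∈ L) : X g v ∈ L := by
    have : L ≤ L.comap ((X g).restrictScalars V) := by
      rw [Submodule.span_le]
      rintro _ ⟨⟨h, i⟩, rfl⟩
      exact Submodule.subset_span ⟨(g * h, i), by simp⟩
    exact this hv
  have hlat : Submodule.IsLattice k L := by
    refine ⟨hfg, ?_⟩
    rw [eq_top_iff, ← (Pi.basisFun k (Fin n)).span_eq]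
    refine Submodule.span_mono ?_
    rintro _ ⟨i, rfl⟩
    exact Submodule.subset_span ⟨(1, i), by simp⟩
  -- Over the Bézout domain V torsion-free means flat, and a finitely generated flat module over a
  -- local ring is free.
  have hfree : Module.Free V L := by
    have : Module.Flat V L := by
      rw [Module.Flat.flat_iff_torsion_eq_bot_of_isBezout]
      rw [eq_bot_iff]
      rintro x ⟨⟨r, hr⟩, hx⟩
      have hr0 : r ≠ 0 := nonZeroDivisors.ne_zero hr
      have hx' : (r : k) • (x : Fin n → k) = 0 := congrArg Subtype.val hx
      have := (smul_eq_zero.mp hx').resolve_left (fun h => hr0 (Subtype.ext h))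
      exact Subtype.ext this
    exact Module.free_of_flat_of_isLocalRing
  let b := finBasis V L
  let b' := b.extendOfIsLattice k
  let Xr : G →* Module.End V L :=
    { toFun := fun g => ((X g).restrictScalars V).restrict (hLX g)
      map_one' := by ext; simp
      map_mul' := fun g h => by
        apply LinearMap.ext
        intro v
        apply Subtype.ext
        change X (g * h) v = X g (X h v)
        rw [map_mul]
        rfl }
  refine ⟨_, (MonoidHomClass.toMonoidHom (LinearMap.toMatrixAlgEquiv b)).comp Xr, fun g => ?_⟩
  rw [← Matrix.charpoly_map, ← LinearMap.charpoly_toMatrix (X g) b']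
  congr 1
  ext i j
  rw [LinearMap.toMatrix_apply]
  have hXb : X g (b' j) = ∑ l, ((b.repr (Xr g (b j)) l : V) : k) • b' l := by
    have h1 := congrArg Subtype.val (b.sum_repr (Xr g (b j)))
    simp only [b', Module.Basis.extendOfIsLattice_apply]
    rw [Submodule.coe_sum] at h1
    exact h1.symm
  rw [hXb, Module.Basis.repr_sum_self]
  simp [LinearMap.toMatrixAlgEquiv_apply]

section decomposition

variable {G : Type*} [Group G] [Finite G] {p : ℕ} {I : Ideal R} [I.IsMaximal]

theorem exists_brauerCharacter_eq_restr (hp : p.Prime) (hI : (p : R) ∈ I) {n : ℕ}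
    (X : Representation K G (Fin n → K)) :
    ∃ (m : ℕ) (Z : Representation (F I) G (Fin m → F I)),
      brauerCharacter p I Z = restr p fun g => ((X.character g : K) : ℂ) := by
  obtain ⟨V, red, hred⟩ := exists_valuationSubring hp hI
  obtain ⟨m, Y, hY⟩ := exists_integral_form V X
  let Z : Representation (F I) G (Fin m → F I) :=
    { toFun := fun g => Matrix.toLin' ((Y g).map red)
      map_one' := by
        rw [map_one, Matrix.map_one _ (map_zero _) (map_one _), Matrix.toLin'_one]
        rfl
      map_mul' := fun g h => by rw [map_mul, Matrix.map_mul, Matrix.toLin'_mul]; rfl }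
  refine ⟨m, Z, funext fun g => ?_⟩
  rw [brauerCharacter_apply, brauerR, restr]
  split_ifs with hg
  · simp
  have hm := (not_dvd_orderOf_iff hp g).mp hg
  have hXg : X g ^ primePart G p = 1 := by rw [← map_pow, hm, map_one]
  choose! lift hlift using fun (z : K) (hz : z ∈ (X g).charpoly.roots) =>
    exists_eq_of_pow_eq_one (primePart_pos G p) (pow_eq_one_of_mem_roots_charpoly hXg hz)
  let s : Multiset R := (X g).charpoly.roots.map lift
  have hs : s.map (algebraMap R K) = (X g).charpoly.roots := by
    rw [Multiset.map_map]
    conv_rhs => rw [← Multiset.map_id (X g).charpoly.roots]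
    exact Multiset.map_congr rfl fun z hz => (hlift z hz).1
  have hsm (r : R) (hr : r ∈ s) : r ^ primePart G p = 1 := by
    obtain ⟨z, hz, rfl⟩ := Multiset.mem_map.mp hr
    exact (hlift z hz).2
  let incl : R → V := fun r => ⟨r, (hred r).choose⟩
  have hincl (r : R) : red (incl r) = Ideal.Quotient.mk I r := (hred r).choose_spec
  -- The eigenvalues of X g are roots of unity in R, so the factorization already holds over V and
  -- can be reduced; `rootLift` then recovers them.
  have hYg : (Y g).charpoly = (s.map fun r => Polynomial.X - Polynomial.C (incl r)).prod := by
    apply Polynomial.map_injective V.subtype V.subtype_injective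
    rw [← hY g, Polynomial.map_multiset_prod, Multiset.map_map,
      (IsAlgClosed.splits (X g).charpoly).eq_prod_roots_of_monic (X g).charpoly_monic, ← hs,
      Multiset.map_map]
    congr 1
    exact Multiset.map_congr rfl fun r _ => by
      simp only [Function.comp_apply, Polynomial.map_sub, Polynomial.map_X, Polynomial.map_C]
      rfl
  have hZg : (Z g).charpoly =
      (s.map fun r => Polynomial.X - Polynomial.C (Ideal.Quotient.mk I r)).prod := by
    change (Matrix.toLin' ((Y g).map red)).charpoly = _
    rw [Matrix.charpoly_toLin', Matrix.charpoly_map, hYg, Polynomial.map_multiset_prod,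
      Multiset.map_map]
    congr 1
    exact Multiset.map_congr rfl fun r _ => by
      simp only [Function.comp_apply, Polynomial.map_sub, Polynomial.map_X, Polynomial.map_C, hincl]
  have hroots : (Z g).charpoly.roots = s.map (Ideal.Quotient.mk I) := by
    rw [hZg, ← Polynomial.roots_multiset_prod_X_sub_C (s.map (Ideal.Quotient.mk I)),
      Multiset.map_map (fun y => Polynomial.X - Polynomial.C y) (Ideal.Quotient.mk I) s]
    rfl
  have hlift' : (Z g).charpoly.roots.map (rootLift G p I) = s := by
    rw [hroots, Multiset.map_map]
    conv_rhs => rw [← Multiset.map_id s]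
    exact Multiset.map_congr rfl fun r hr => rootLift_mk hp hI (hsm r hr)
  rw [hlift', Representation.character, trace_eq_sum_roots, ← hs]
  change ((algebraMap R K s.sum : K) : ℂ) = _
  rw [map_multiset_sum]

/-- The numbers are defined by `Classical.epsilon`, so existence must be shown: χ̂ is the Brauer
character of a reduced integral form. -/
theorem restr_eq_decompositionNumber_sum (hp : p.Prime) (hI : (p : R) ∈ I) (χ : Irr G) :
    restr p (χ : G → ℂ) =
      (decompositionNumber p I χ).sum fun φ m => m • (φ : G → ℂ) := by
  apply Classical.epsilon_spec (p := fun d : IBr G p I →₀ ℕ =>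
    restr p (χ : G → ℂ) = d.sum fun φ m => m • (φ : G → ℂ))
  obtain ⟨n, X, -, hX⟩ := χ.2
  obtain ⟨m, Z, hZ⟩ := exists_brauerCharacter_eq_restr hp hI X
  apply AddSubmonoid.exists_finsupp_of_mem_closure_range
  rw [Subtype.range_coe, hX, ← hZ]
  exact brauerCharacter_mem_closure Z

end decomposition

/-! ### Pairing Brauer characters with projective characters. -/

section pairing

variable {G : Type*} [Group G] [Fintype G] {p : ℕ} {I : Ideal R} [I.IsMaximal]

omit [Group G] in
theorem charInner_add_right (θ u v : G → ℂ) :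
    charInner θ (u + v) = charInner θ u + charInner θ v := by
  simp [charInner, mul_add, Finset.sum_add_distrib]

omit [Group G] in
/-- The inner product with a fixed function, as an additive map in the second argument. -/
def charInnerHom (θ : G → ℂ) : (G → ℂ) →+ ℂ where
  toFun := charInner θ
  map_zero' := by simp [charInner]
  map_add' := charInner_add_right θ

omit [Fintype G] in
theorem exists_sum_irreducible_of_mem {θ : G → ℂ} (hθ : θ ∈ BrauerCharacters G p I) :
    ∃ m : IBr G p I →₀ ℕ, θ = m.sum fun φ a => a • (φ : G → ℂ) := by
  obtain ⟨n, X, rfl⟩ := hθ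
  apply AddSubmonoid.exists_finsupp_of_mem_closure_range
  rw [Subtype.range_coe]
  exact brauerCharacter_mem_closure X

/-- The inner products of a Brauer character with the projective indecomposable characters are the
multiplicities of its irreducible constituents. -/
theorem charInner_pim (hp : p.Prime) (hI : (p : R) ∈ I) {θ : G → ℂ}
    (hθ : θ ∈ BrauerCharacters G p I) {m : IBr G p I →₀ ℕ}
    (hm : θ = m.sum fun φ a => a • (φ : G → ℂ)) (ψ : IBr G p I) :
    charInner θ (pim p I ψ) = m ψ := by
  classical
  obtain ⟨n, X, rfl⟩ := hθ
  have := finite_irr (G := G)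
  have := Fintype.ofFinite (Irr G)
  obtain ⟨a, ha, hexp⟩ := exists_irr_expansion (fun g => (brauerR p X g : K))
    (fun g h => by rw [brauerR_conj])
  have hX : (fun g => ((brauerR p X g : K) : ℂ)) = brauerCharacter p I X :=
    funext fun g => (brauerCharacter_apply X g).symm
  rw [hX] at ha
  let toK : (IBr G p I →₀ ℕ) → (IBr G p I →₀ K) := Finsupp.mapRange Nat.cast Nat.cast_zero
  have htoK (d : IBr G p I →₀ ℕ) :
      Finsupp.linearCombination K (fun φ : IBr G p I => (φ : G → ℂ)) (toK d) =
        d.sum fun φ a => a • (φ : G → ℂ) := by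
    rw [Finsupp.linearCombination_apply, Finsupp.sum_mapRange_index (by simp)]
    simp [Nat.cast_smul_eq_nsmul]
  have hsum : brauerCharacter p I X = ∑ χ : Irr G, a χ • restr p (χ : G → ℂ) := by
    funext g
    rw [Finset.sum_apply]
    by_cases hg : p ∣ orderOf g
    · simp [restr, brauerCharacter, hg]
    · rw [brauerCharacter_apply, hexp g]
      refine Finset.sum_congr rfl fun χ _ => ?_
      rw [Pi.smul_apply, restr, if_neg hg]
      rfl
  -- The a χ lie in K and need not be integers, so independence over K is required.
  have hcoef : toK m = ∑ χ : Irr G, a χ • toK (decompositionNumber p I χ) := by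
    apply linearIndependent_IBr (G := G) hp hI
    rw [htoK, ← hm, hsum, map_sum]
    refine Finset.sum_congr rfl fun χ _ => ?_
    rw [map_smul, htoK, restr_eq_decompositionNumber_sum hp hI χ]
  have hψ : ((m ψ : K) : ℂ) = ∑ χ : Irr G, (a χ : ℂ) * decompositionNumber p I χ ψ := by
    have h1 : (m ψ : K) = ∑ χ : Irr G, a χ * decompositionNumber p I χ ψ := by
      simpa [toK, Finsupp.finsetSum_apply] using congrArg (fun f => f ψ) hcoef
    rw [h1]
    simp
  have hpim : pim p I ψ = ∑ χ : Irr G, decompositionNumber p I χ ψ • (χ : G → ℂ) :=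
    finsum_eq_sum_of_fintype _
  change charInnerHom _ _ = _
  rw [hpim, map_sum]
  simp only [map_nsmul]
  rw [show (m ψ : ℂ) = ((m ψ : K) : ℂ) by simp, hψ]
  refine Finset.sum_congr rfl fun χ _ => ?_
  rw [ha χ, nsmul_eq_mul, mul_comm]
  rfl

theorem exists_charInner_eq_natCast (hp : p.Prime) (hI : (p : R) ∈ I) {θ Φ : G → ℂ}
    (hθ : θ ∈ BrauerCharacters G p I) (hΦ : Φ ∈ ProjectiveCharacters G p I) :
    ∃ n : ℕ, charInner θ Φ = n := by
  obtain ⟨m, hm⟩ := exists_sum_irreducible_of_mem hθ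
  induction hΦ using AddSubmonoid.closure_induction with
  | mem x hx =>
    obtain ⟨ψ, rfl⟩ := hx
    exact ⟨m ψ, charInner_pim hp hI hθ hm ψ⟩
  | zero => exact ⟨0, by simp [charInner]⟩
  | add x y _ _ hx hy =>
    obtain ⟨a, ha⟩ := hx
    obtain ⟨b, hb⟩ := hy
    exact ⟨a + b, by rw [charInner_add_right, ha, hb, Nat.cast_add]⟩

omit [Fintype G] in
theorem IBr_mem_brauerCharacters (φ : IBr G p I) : (φ : G → ℂ) ∈ BrauerCharacters G p I := by
  obtain ⟨n, X, -, hX⟩ := φ.2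
  exact ⟨n, X, hX⟩

theorem charInner_pim_irreducible (hp : p.Prime) (hI : (p : R) ∈ I) [DecidableEq (IBr G p I)]
    (φ ψ : IBr G p I) :
    charInner (φ : G → ℂ) (pim p I ψ) = if φ = ψ then 1 else 0 := by
  rw [charInner_pim hp hI (IBr_mem_brauerCharacters φ) (m := Finsupp.single φ 1) (by simp) ψ,
    Finsupp.single_apply]
  split_ifs <;> simp

omit [Fintype G] in
theorem mem_K0_of_add_mem_K0 [Finite G] (hp : p.Prime) (hI : (p : R) ∈ I) {B : Set (Block G p I)}
    {Φ₁ Φ₂ : G → ℂ} (h₁ : Φ₁ ∈ ProjectiveCharacters G p I)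
    (h₂ : Φ₂ ∈ ProjectiveCharacters G p I) (h : Φ₁ + Φ₂ ∈ K0 B) : Φ₁ ∈ K0 B := by
  classical
  have := Fintype.ofFinite G
  obtain ⟨a, rfl⟩ := AddSubmonoid.exists_finsupp_of_mem_closure_range _ _ h₁
  refine Submodule.sum_mem _ fun ψ hψ => ?_
  by_cases hψB : ψ ∈ IBrB B
  · exact nsmul_mem (Submodule.subset_span (Set.mem_image_of_mem _ hψB)) _
  exfalso
  -- Pairing with ψ outside IBr(B) kills K₀(B), but here it equals a ψ plus a non-negative integer;
  -- so a ψ = 0.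
  have h0 : charInnerHom (ψ : G → ℂ) ((a.sum fun φ n => n • pim p I φ) + Φ₂) = 0 := by
    have hle : K0 B ≤ LinearMap.ker (charInnerHom (ψ : G → ℂ)).toIntLinearMap := by
      rw [K0, Submodule.span_le]
      rintro _ ⟨φ, hφ, rfl⟩
      refine LinearMap.mem_ker.mpr ((charInner_pim_irreducible hp hI ψ φ).trans (if_neg ?_))
      rintro rfl
      exact hψB hφ
    exact LinearMap.mem_ker.mp (hle h)
  have ha : charInnerHom (ψ : G → ℂ) (a.sum fun φ n => n • pim p I φ) = a ψ := by
    rw [Finsupp.sum, map_sum]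
    simp only [map_nsmul]
    change ∑ φ ∈ a.support, a φ • charInner (ψ : G → ℂ) (pim p I φ) = _
    simp only [charInner_pim_irreducible hp hI]
    simpa using fun h => by simp [h]
  obtain ⟨b, hb⟩ := exists_charInner_eq_natCast hp hI (IBr_mem_brauerCharacters ψ) h₂
  rw [map_add, ha] at h0
  change _ + charInner _ _ = _ at h0
  rw [hb] at h0
  have h0' : a ψ + b = 0 := by exact_mod_cast h0
  exact Finsupp.mem_support_iff.mp hψ (by omega)

theorem exists_nonneg_coefficients (hp : p.Prime) (hI : (p : R) ∈ I) {B : Set (Block G p I)}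
    {ι : Type*} [Fintype ι] [DecidableEq ι] {BS PA : ι → G → ℂ} (hBS : IsBasicSet B BS)
    (hPA : IsDualAtoms B BS PA) {Φ : G → ℂ} (hΦ : Φ ∈ ProjectiveCharacters G p I)
    (hΦB : Φ ∈ K0 B) : ∃ c : ι → ℤ, Φ = ∑ i, c i • PA i ∧ ∀ i, 0 ≤ c i := by
  rw [← hPA.1.2, Submodule.mem_span_range_iff_exists_fun] at hΦB
  obtain ⟨c, hc⟩ := hΦB
  refine ⟨c, hc.symm, fun i => ?_⟩
  obtain ⟨n, hn⟩ := exists_charInner_eq_natCast hp hI (hBS.2 i) hΦ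
  have h : charInnerHom (BS i) Φ = c i := by
    rw [← hc, map_sum]
    simp only [map_zsmul]
    change ∑ j, c j • charInner (BS i) (PA j) = _
    simp [hPA.2]
  have h' : (n : ℂ) = (c i : ℂ) := hn.symm.trans h
  have : (n : ℤ) = c i := by exact_mod_cast h'
  omega

-- Split one PIM off a sum of PIMs: indecomposability forces that PIM or the remainder to vanish.
omit [Fintype G] in
theorem IsIndecomposable.mem_IPr {Φ : G → ℂ} (h : IsIndecomposable p I Φ) : Φ ∈ IPr G p I := by
  obtain ⟨hΦ, h0, hdec⟩ := h
  induction hΦ using AddSubmonoid.closure_induction_left with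
  | zero => exact absurd rfl h0
  | add_left x hx y hy ih =>
    rcases hdec x (AddSubmonoid.subset_closure hx) y hy rfl with rfl | rfl
    · simp only [zero_add] at h0 hdec ⊢
      exact ih h0 hdec
    · rwa [add_zero]

end pairing

end PIMTest

end

/-! ### The PIM-test. -/

theorem mainTheorem7 {G : Type*} [Group G] [Fintype G] (p : ℕ) (hp : p.Prime)
    (I : Ideal PIMTest.R) [I.IsMaximal] (hI : (p : PIMTest.R) ∈ I)
    (B : Set (PIMTest.Block G p I))
    {ι : Type*} [Fintype ι] [DecidableEq ι] (BS PA : ι → G → ℂ)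
    (hBS : PIMTest.IsBasicSet B BS) (hPA : PIMTest.IsDualAtoms B BS PA)
    (Br : Set (G → ℂ)) (hBr : Br ⊆ PIMTest.BrauerCharacters G p I)
    (Φ : G → ℂ) (hΦ : Φ ∈ PIMTest.ProjectiveCharacters G p I) (hΦB : Φ ∈ PIMTest.K0 B)
    (hΦ0 : Φ ≠ 0)
    (htest : ∀ Φ' : G → ℂ, PIMTest.IsPart PA Φ Φ' → Φ' ≠ Φ → Φ' ≠ 0 →
      ∃ φ ∈ Br, PIMTest.charInner φ Φ' < 0 ∨ PIMTest.charInner φ (Φ - Φ') < 0) :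
    PIMTest.IsIndecomposable p I Φ ∧ Φ ∈ PIMTest.IPr G p I := by
  have hind : PIMTest.IsIndecomposable p I Φ := by
    refine ⟨hΦ, hΦ0, fun Φ₁ h₁ Φ₂ h₂ hsum => ?_⟩
    subst hsum
    by_contra! hne
    obtain ⟨c₁, hc₁, hpos₁⟩ := PIMTest.exists_nonneg_coefficients hp hI hBS hPA h₁
      (PIMTest.mem_K0_of_add_mem_K0 hp hI h₁ h₂ hΦB)
    obtain ⟨c₂, hc₂, hpos₂⟩ := PIMTest.exists_nonneg_coefficients hp hI hBS hPA h₂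
      (PIMTest.mem_K0_of_add_mem_K0 hp hI h₂ h₁ (add_comm Φ₁ Φ₂ ▸ hΦB))
    have hpart : PIMTest.IsPart PA (Φ₁ + Φ₂) Φ₁ := by
      refine ⟨c₁ + c₂, c₁, ?_, hc₁, fun i => ⟨hpos₁ i, ?_⟩⟩
      · conv_lhs => rw [hc₁, hc₂]
        simp [add_smul, Finset.sum_add_distrib]
      · simpa using hpos₂ i
    have hnat {φ Ψ : G → ℂ} (hφ : φ ∈ Br) (hΨ : Ψ ∈ PIMTest.ProjectiveCharacters G p I) :
        ¬ PIMTest.charInner φ Ψ < 0 := by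
      obtain ⟨n, hn⟩ := PIMTest.exists_charInner_eq_natCast hp hI (hBr hφ) hΨ
      rw [hn]
      exact not_lt_of_ge (Nat.cast_nonneg n)
    obtain ⟨φ, hφ, h | h⟩ := htest Φ₁ hpart (by simpa using hne.2) hne.1
    · exact hnat hφ h₁ h
    · rw [add_sub_cancel_left] at h
      exact hnat hφ h₂ h
  exact ⟨hind, hind.mem_IPr⟩
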